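/- Consider a Bell scenario $(n+1,m,v)$: parties $i=1,\dots,n+1$, where party $i$ has $m_i\ge 1$ measurements and measurement $j$ of party $i$ has $v_{ij}\ge 1$ outcomes. For each assignment $\lambda$ of an outcome $\lambda_{ij}\in\{1,\dots,v_{ij}\}$ to every measurement $j$ of every party $i$, let $p^\lambda$ be the vector with components $p^\lambda_{k_1\dots k_{n+1}|j_1\dots j_{n+1}}=1$ if $\lambda_{ij_i}=k_i$ for all $i$, and $0$ otherwise. The Bell polytope $\mathcal B^{n+1}$ is the convex hull of the vectors $p^\lambda$. Fix a party $i'$, one of its measurements $j'$ with $v_{i'j'}\ge 2$, and an outcome $k'$ of $j'$. Let $\mathcal B$ be the Bell polytope, defined in the same way, of the $n$ parties other than $i'$, and suppose that at least one measurement of these $n$ parties has at least two outcomes. For $p\in\mathbb R^{t}$, where $t=\prod_{i=1}^{n+1}\sum_{j=1}^{m_i}v_{ij}$ is the number of components of an $(n+1)$-party vector, let $p(i',j',k')$ be the restriction of $p$ to the components with $j_{i'}=j'$ and $k_{i'}=k'$, regarded as a vector indexed by the settings and outcomes of the other $n$ parties. An inequality $b\cdot p\ge b_0$ that is valid on a polytope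 $P$ (i.e. holds for all $p\in P$) is said to support a facet of $P$ if the face $F=\{p\in P: b\cdot p=b_0\}$ satisfies $F\ne\emptyset$, $F\neq P$ and $\dim F=\dim P-1$, where $\dim$ is the dimension of the affine hull. Let $b\cdot p\ge 0$ be a valid inequality for $\mathcal B$. Then $b\cdot p\ge 0$ supports a facet of $\mathcal B$ if and only if the lifted inequality $b\cdot p(i',j',k')\ge 0$ supports a facet of $\mathcal B^{n+1}$. -/

import Mathlib

open scoped Matrix

/-- Indices of the components of a probability vector in the Bell scenario with `n` parties, where
party `i` has `m i` measurements and measurement `j` of party `i` has `v i j` outcomes: a measurement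
setting `j` together with an outcome `k` of it, for every party. The component of `p` at `c` is
`p_{k₁ … kₙ | j₁ … jₙ}` with `c i = ⟨jᵢ, kᵢ⟩`. -/
abbrev BellIndex {n : ℕ} (m : Fin n → ℕ) (v : (i : Fin n) → Fin (m i) → ℕ) : Type :=
  (i : Fin n) → (j : Fin (m i)) × Fin (v i j)

/-- The space `ℝ^t` of joint probability vectors. -/
abbrev BellVec {n : ℕ} (m : Fin n → ℕ) (v : (i : Fin n) → Fin (m i) → ℕ) : Type :=
  BellIndex m v → ℝ

/-- An assignment of one outcome to each measurement of each party. -/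
abbrev BellAssignment {n : ℕ} (m : Fin n → ℕ) (v : (i : Fin n) → Fin (m i) → ℕ) : Type :=
  (i : Fin n) → (j : Fin (m i)) → Fin (v i j)

open Classical in
/-- The deterministic vector `p^lam`: its component at `c` is `1` if `lam` assigns to every chosen
measurement the prescribed outcome, and `0` otherwise. -/
noncomputable def detVec {n : ℕ} {m : Fin n → ℕ} {v : (i : Fin n) → Fin (m i) → ℕ}
    (lam : BellAssignment m v) : BellVec m v :=
  fun c => if ∀ i, lam i (c i).1 = (c i).2 then 1 else 0

/-- The Bell polytope: the convex hull of the deterministic vectors. -/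
def bellPolytope {n : ℕ} (m : Fin n → ℕ) (v : (i : Fin n) → Fin (m i) → ℕ) :
    Set (BellVec m v) :=
  convexHull ℝ (Set.range (detVec (m := m) (v := v)))

/-- The dimension of the affine hull of a set (used for nonempty sets). -/
noncomputable def affineDim {E : Type*} [AddCommGroup E] [Module ℝ E] (S : Set E) : ℕ :=
  Module.finrank ℝ (affineSpan ℝ S).direction

/-- The inequality `f p ≥ b₀` holds on all of `P`. -/
def IsValidIneq {E : Type*} [AddCommGroup E] [Module ℝ E] (P : Set E) (f : E →ₗ[ℝ] ℝ) (b₀ : ℝ) :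
    Prop :=
  ∀ p ∈ P, b₀ ≤ f p

/-- The face `{p ∈ P | f p = b₀}` of `P` supported by a valid inequality `f p ≥ b₀`. -/
def supportedFace {E : Type*} [AddCommGroup E] [Module ℝ E] (P : Set E) (f : E →ₗ[ℝ] ℝ) (b₀ : ℝ) :
    Set E :=
  {p ∈ P | f p = b₀}

/-- The inequality `f p ≥ b₀` is valid for `P`, and the face it supports is a facet: a proper face
(neither empty nor all of `P`) of dimension `dim P - 1`. -/
def SupportsFacet {E : Type*} [AddCommGroup E] [Module ℝ E] (P : Set E) (f : E →ₗ[ℝ] ℝ) (b₀ : ℝ) :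
    Prop :=
  IsValidIneq P f b₀ ∧ (supportedFace P f b₀).Nonempty ∧ supportedFace P f b₀ ≠ P ∧
    affineDim (supportedFace P f b₀) + 1 = affineDim P

/-- The linear form `p ↦ b · p`. -/
def dotForm {ι : Type*} [Fintype ι] (b : ι → ℝ) : (ι → ℝ) →ₗ[ℝ] ℝ where
  toFun p := b ⬝ᵥ p
  map_add' := dotProduct_add b
  map_smul' r p := dotProduct_smul r b p

/-- The restriction `p ↦ p(i', j', k')` of an `(n+1)`-party vector to the components where party `i'`
measures `j'` and obtains `k'`. Its components are indexed by the settings and outcomes of the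
remaining `n` parties, the `i`-th of which is party `i'.succAbove i` of the `n+1`. -/
def restrictParty {n : ℕ} {m : Fin (n + 1) → ℕ} {v : (i : Fin (n + 1)) → Fin (m i) → ℕ}
    (i' : Fin (n + 1)) (j' : Fin (m i')) (k' : Fin (v i' j')) :
    BellVec m v →ₗ[ℝ] BellVec (fun i => m (i'.succAbove i)) (fun i => v (i'.succAbove i)) where
  toFun p := fun c => p (i'.insertNth ⟨j', k'⟩ c)
  map_add' _ _ := rfl
  map_smul' _ _ := rfl

/-! ### Convex geometry and linear algebra of faces. -/

section Generalities

variable {E E' : Type*} [AddCommGroup E] [Module ℝ E] [AddCommGroup E'] [Module ℝ E']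

/-! Normalization puts both polytopes in affine hyperplanes missing the origin, so a facet is a face
whose linear span has codimension one (`supportsFacet_iff_finrank`), and that span is generated by
the deterministic vectors on the face. Restriction `R` maps the span of the large polytope onto that
of the small one, and the span `G` of the lifted face onto that of the original face. By
`finrank_add_one_eq_iff_map` it remains to see that vectors of the large span killed by `R` lie in
`G`. Modulo `G`, a vector `x` equals a fixed strategy of party `i'` times `R x`: strategies avoiding
`k'` give vectors in `G`, and two strategies choosing `k'` differ by two avoiding it
(`extendParty_sub_extendParty_update`). -/

/-- The face supported by a valid inequality `0 ≤ f` on a convex hull is spanned by the generators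
lying on it. -/
theorem span_supportedFace_convexHull (X : Set E) (f : E →ₗ[ℝ] ℝ) (hf : ∀ x ∈ X, 0 ≤ f x) :
    Submodule.span ℝ (supportedFace (convexHull ℝ X) f 0) =
      Submodule.span ℝ {x ∈ X | f x = 0} := by
  apply le_antisymm
  · rw [Submodule.span_le]
    rintro p ⟨hp, hfp⟩
    have key : convexHull ℝ X ⊆
        {p | 0 ≤ f p ∧ (f p = 0 → p ∈ Submodule.span ℝ {x ∈ X | f x = 0})} := by
      apply convexHull_min
      · intro x hx
        exact ⟨hf x hx, fun h => Submodule.subset_span ⟨hx, h⟩⟩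
      -- Strictly positive weights are needed: a vanishing sum of nonnegative terms then forces `f x
      -- = f y = 0`.
      · rw [convex_iff_forall_pos]
        rintro x ⟨hx, hx'⟩ y ⟨hy, hy'⟩ s t hs ht -
        have e : f (s • x + t • y) = s * f x + t * f y := by simp
        refine ⟨by rw [e]; positivity, fun h => ?_⟩
        rw [e] at h
        have h1 : 0 ≤ s * f x := by positivity
        have h2 : 0 ≤ t * f y := by positivity
        have hx0 : f x = 0 := by
          have : s * f x = 0 := by linarith
          simpa [hs.ne'] using this
        have hy0 : f y = 0 := by
          have : t * f y = 0 := by linarith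
          simpa [ht.ne'] using this
        exact add_mem (Submodule.smul_mem _ _ (hx' hx0)) (Submodule.smul_mem _ _ (hy' hy0))
    exact (key hp).2 hfp
  · apply Submodule.span_mono
    rintro x ⟨hx, h⟩
    exact ⟨subset_convexHull ℝ X hx, h⟩

theorem span_convexHull (X : Set E) :
    Submodule.span ℝ (convexHull ℝ X) = Submodule.span ℝ X := by
  apply le_antisymm
  · rw [Submodule.span_le]
    exact convexHull_min Submodule.subset_span (Submodule.convex _)
  · exact Submodule.span_mono (subset_convexHull ℝ X)

/-- A nonempty set in an affine hyperplane missing the origin spans one more dimension linearly than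
it does affinely. -/
theorem affineDim_add_one [FiniteDimensional ℝ E] {S : Set E} (hS : S.Nonempty) (g : E →ₗ[ℝ] ℝ)
    (hg : ∀ x ∈ S, g x = 1) :
    affineDim S + 1 = Module.finrank ℝ (Submodule.span ℝ S) := by
  obtain ⟨p, hp⟩ := hS
  have hker : vectorSpan ℝ S ≤ LinearMap.ker g := by
    rw [vectorSpan_def, Submodule.span_le]
    rintro _ ⟨x, hx, y, hy, rfl⟩
    simp [hg x hx, hg y hy]
  have hp0 : p ≠ 0 := by
    rintro rfl
    simpa using hg 0 hp
  have hsup : vectorSpan ℝ S ⊔ Submodule.span ℝ {p} = Submodule.span ℝ S := by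
    apply le_antisymm
    · refine sup_le ?_ (Submodule.span_mono (by simpa using hp))
      rw [vectorSpan_def, Submodule.span_le]
      rintro _ ⟨x, hx, y, hy, rfl⟩
      exact sub_mem (Submodule.subset_span hx) (Submodule.subset_span hy)
    · rw [Submodule.span_le]
      intro x hx
      have h : x = (x - p) + p := by abel
      rw [SetLike.mem_coe, h]
      exact Submodule.add_mem_sup (vsub_mem_vectorSpan ℝ hx hp)
        (Submodule.mem_span_singleton_self p)
  have hinf : vectorSpan ℝ S ⊓ Submodule.span ℝ {p} = ⊥ := by
    rw [eq_bot_iff]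
    rintro x ⟨hx, hx'⟩
    obtain ⟨a, rfl⟩ := Submodule.mem_span_singleton.1 hx'
    have h : g (a • p) = 0 := hker hx
    have ha : a = 0 := by simpa [hg p hp] using h
    simp [ha]
  have h := Submodule.finrank_sup_add_finrank_inf_eq (vectorSpan ℝ S) (Submodule.span ℝ {p})
  rw [hsup, hinf, finrank_bot, finrank_span_singleton hp0] at h
  rw [affineDim, direction_affineSpan]
  omega

/-- For a polytope of positive dimension in an affine hyperplane missing the origin, facets are the
faces whose linear span has codimension one. -/
theorem supportsFacet_iff_finrank [FiniteDimensional ℝ E] {P : Set E} (f g : E →ₗ[ℝ] ℝ)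
    (hf : IsValidIneq P f 0) (hg : ∀ x ∈ P, g x = 1) (hP : P.Nontrivial) :
    SupportsFacet P f 0 ↔
      Module.finrank ℝ (Submodule.span ℝ (supportedFace P f 0)) + 1 =
        Module.finrank ℝ (Submodule.span ℝ P) := by
  have hgF : ∀ x ∈ supportedFace P f 0, g x = 1 := fun x hx => hg x hx.1
  have hdim := affineDim_add_one hP.nonempty g hg
  constructor
  · rintro ⟨-, hne, -, h⟩
    rw [← affineDim_add_one hne g hgF, ← hdim, h]
  · intro h
    have hne : (supportedFace P f 0).Nonempty := by
      rw [Set.nonempty_iff_ne_empty]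
      -- An empty face would make the span of `P` a line, which meets `g = 1` only once, against
      -- `hP`.
      intro he
      rw [he, Submodule.span_empty, finrank_bot] at h
      obtain ⟨x, hx, y, hy, hxy⟩ := hP
      have hx0 : (⟨x, Submodule.subset_span hx⟩ : Submodule.span ℝ P) ≠ 0 := by
        intro h0
        have : x = 0 := congrArg Subtype.val h0
        simpa [this] using hg x hx
      obtain ⟨c, hc⟩ := (finrank_eq_one_iff_of_nonzero' _ hx0).1 h.symm
        ⟨y, Submodule.subset_span hy⟩
      have hc' : c • x = y := congrArg Subtype.val hc
      have hc1 : c = 1 := by simpa [hg x hx, hg y hy] using congrArg g hc'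
      exact hxy (by simpa [hc1] using hc')
    refine ⟨hf, hne, fun he => ?_, ?_⟩
    · rw [he] at h
      omega
    · have := affineDim_add_one hne g hgF
      omega

/-- Submodules `U ≤ V` with the same intersection with the kernel of `R` have the same relative
codimension as their images. -/
theorem finrank_add_one_eq_iff_map [FiniteDimensional ℝ E] (R : E →ₗ[ℝ] E') {U V : Submodule ℝ E}
    (hUV : U ≤ V) (hker : V ⊓ LinearMap.ker R ≤ U) :
    Module.finrank ℝ U + 1 = Module.finrank ℝ V ↔
      Module.finrank ℝ (U.map R) + 1 = Module.finrank ℝ (V.map R) := by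
  -- Rank-nullity for `R` restricted to `W`.
  have key (W : Submodule ℝ E) : Module.finrank ℝ (W.map R) +
      Module.finrank ℝ (W ⊓ LinearMap.ker R : Submodule ℝ E) = Module.finrank ℝ W := by
    have h := LinearMap.finrank_range_add_finrank_ker (R.domRestrict W)
    rw [LinearMap.range_domRestrict, LinearMap.ker_domRestrict] at h
    rw [← h, ← Submodule.map_comap_subtype, Submodule.finrank_map_subtype_eq]
  have hinf : U ⊓ LinearMap.ker R = V ⊓ LinearMap.ker R :=
    le_antisymm (inf_le_inf_right _ hUV) (le_inf hker inf_le_right)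
  have hU := key U
  have hV := key V
  rw [hinf] at hU
  omega

end Generalities

/-! ### Normalization and nontriviality of Bell polytopes. -/

section Bell

variable {n : ℕ} {m : Fin n → ℕ} {v : (i : Fin n) → Fin (m i) → ℕ}

/-- The total probability of all outcomes for the setting `s`. -/
noncomputable def totalProb (s : (i : Fin n) → Fin (m i)) : BellVec m v →ₗ[ℝ] ℝ :=
  ∑ k : (i : Fin n) → Fin (v i (s i)), LinearMap.proj (fun i => ⟨s i, k i⟩)

theorem totalProb_detVec (s : (i : Fin n) → Fin (m i)) (lam : BellAssignment m v) :
    totalProb s (detVec lam) = 1 := by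
  classical
  -- Exactly one outcome tuple agrees with `lam` on `s`, so the sum has a single nonzero term.
  simp only [totalProb, LinearMap.sum_apply, LinearMap.proj_apply, detVec, ← funext_iff]
  simp

theorem totalProb_eq_one_of_mem (s : (i : Fin n) → Fin (m i)) :
    ∀ p ∈ bellPolytope m v, totalProb s p = 1 := by
  have h : bellPolytope m v ⊆ {p | totalProb s p = 1} := by
    apply convexHull_min
    · rintro _ ⟨lam, rfl⟩
      exact totalProb_detVec s lam
    · exact convex_hyperplane (totalProb s).isLinear 1
  exact h

theorem detVec_mem_bellPolytope (lam : BellAssignment m v) : detVec lam ∈ bellPolytope m v :=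
  subset_convexHull ℝ _ ⟨lam, rfl⟩

theorem bellPolytope_nontrivial (hm : ∀ i, 1 ≤ m i) (hv : ∀ i j, 1 ≤ v i j)
    (h : ∃ i j, 2 ≤ v i j) : (bellPolytope m v).Nontrivial := by
  classical
  obtain ⟨i, j, hij⟩ := h
  let lam : BellAssignment m v := fun i j => ⟨0, hv i j⟩
  let lam' : BellAssignment m v :=
    Function.update lam i (Function.update (lam i) j ⟨1, hij⟩)
  refine ⟨_, detVec_mem_bellPolytope lam, _, detVec_mem_bellPolytope lam', fun he => ?_⟩
  obtain ⟨s, hs⟩ : ∃ s : (i : Fin n) → Fin (m i), s i = j :=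
    ⟨Function.update (fun i => ⟨0, hm i⟩) i j, by simp⟩
  have h0 := congrFun he (fun i => ⟨s i, lam i (s i)⟩)
  have h1 : ¬ ∀ a, lam' a (s a) = lam a (s a) := by
    intro h
    have := h i
    rw [hs] at this
    simp [lam', lam] at this
  simp [detVec, h1] at h0

end Bell

/-! ### Product vectors and restriction to one outcome. -/

section Lifting

variable {n : ℕ} {m : Fin (n + 1) → ℕ} {v : (i : Fin (n + 1)) → Fin (m i) → ℕ} (i' : Fin (n + 1))

/-- The assignment in which party `i'` uses `mu` and the remaining parties use `lam`. -/
def insertAssignment (mu : (j : Fin (m i')) → Fin (v i' j))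
    (lam : BellAssignment (fun i => m (i'.succAbove i)) (fun i => v (i'.succAbove i))) :
    BellAssignment m v :=
  i'.insertNth (α := fun i => (j : Fin (m i)) → Fin (v i j)) mu lam

open Classical in
/-- The probability that the deterministic strategy `mu` assigns to a setting and outcome. -/
noncomputable def strategyWeight {l : ℕ} {w : Fin l → ℕ} (mu : (j : Fin l) → Fin (w j))
    (x : (j : Fin l) × Fin (w j)) : ℝ :=
  if mu x.1 = x.2 then 1 else 0

/-- The product of the deterministic strategy `mu` of party `i'` with a vector of the remaining
parties. -/
noncomputable def extendParty (mu : (j : Fin (m i')) → Fin (v i' j)) :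
    BellVec (fun i => m (i'.succAbove i)) (fun i => v (i'.succAbove i)) →ₗ[ℝ] BellVec m v where
  toFun q := fun c => strategyWeight mu (c i') * q (fun i => c (i'.succAbove i))
  map_add' q r := by ext c; simp [mul_add]
  map_smul' a q := by ext c; simp [mul_left_comm]

theorem detVec_insertAssignment (mu : (j : Fin (m i')) → Fin (v i' j))
    (lam : BellAssignment (fun i => m (i'.succAbove i)) (fun i => v (i'.succAbove i))) :
    detVec (insertAssignment i' mu lam) = extendParty i' mu (detVec lam) := by
  classical
  ext c
  simp only [detVec, extendParty, strategyWeight, LinearMap.coe_mk, AddHom.coe_mk, insertAssignment,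
    Fin.forall_iff_succAbove i', Fin.insertNth_apply_same, Fin.insertNth_apply_succAbove, ite_and]
  split_ifs <;> simp

theorem range_detVec_eq : Set.range (detVec (m := m) (v := v)) =
    {p | ∃ mu lam, extendParty i' mu (detVec lam) = p} := by
  ext p
  constructor
  · rintro ⟨nu, rfl⟩
    refine ⟨nu i', fun i => nu (i'.succAbove i), ?_⟩
    rw [← detVec_insertAssignment]
    congr 1
    exact Fin.insertNth_self_removeNth (α := fun i => (j : Fin (m i)) → Fin (v i j)) i' nu
  · rintro ⟨mu, lam, rfl⟩
    exact ⟨insertAssignment i' mu lam, detVec_insertAssignment i' mu lam⟩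

variable {i'} (j' : Fin (m i')) (k' : Fin (v i' j'))

theorem restrictParty_extendParty_of_eq {mu : (j : Fin (m i')) → Fin (v i' j)} (h : mu j' = k')
    (q : BellVec (fun i => m (i'.succAbove i)) (fun i => v (i'.succAbove i))) :
    restrictParty i' j' k' (extendParty i' mu q) = q := by
  ext c
  have hw : strategyWeight mu ⟨j', k'⟩ = 1 := by simp [strategyWeight, h]
  simp [restrictParty, extendParty, hw]

theorem restrictParty_extendParty_of_ne {mu : (j : Fin (m i')) → Fin (v i' j)} (h : mu j' ≠ k')
    (q : BellVec (fun i => m (i'.succAbove i)) (fun i => v (i'.succAbove i))) :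
    restrictParty i' j' k' (extendParty i' mu q) = 0 := by
  ext c
  have hw : strategyWeight mu ⟨j', k'⟩ = 0 := by simp [strategyWeight, h]
  simp [restrictParty, extendParty, hw]

/-- Changing one outcome of a strategy of party `i'` shifts the product vector by an amount that
does not depend on the rest of the strategy. -/
theorem extendParty_sub_extendParty_update (mu nu : (j : Fin (m i')) → Fin (v i' j))
    (h : mu j' = nu j') (k : Fin (v i' j'))
    (q : BellVec (fun i => m (i'.succAbove i)) (fun i => v (i'.succAbove i))) :
    extendParty i' mu q - extendParty i' nu q =
      extendParty i' (Function.update mu j' k) q - extendParty i' (Function.update nu j' k) q := by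
  classical
  ext c
  -- At `j'` the strategies agree both before and after the update, so both differences vanish;
  -- elsewhere the update is invisible.
  by_cases hc : (c i').1 = j'
  · generalize hx : c i' = x at hc
    obtain ⟨j, l⟩ := x
    obtain rfl : j = j' := hc
    simp only [extendParty, LinearMap.coe_mk, AddHom.coe_mk, Pi.sub_apply, hx]
    simp [strategyWeight, h]
  · simp [extendParty, strategyWeight, Function.update_of_ne hc]

end Lifting

theorem theorem3 {n : ℕ} (m : Fin (n + 1) → ℕ) (v : (i : Fin (n + 1)) → Fin (m i) → ℕ)
    (hm : ∀ i, 1 ≤ m i) (hv : ∀ i j, 1 ≤ v i j)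
    (i' : Fin (n + 1)) (j' : Fin (m i')) (k' : Fin (v i' j')) (hv' : 2 ≤ v i' j')
    (hB : ∃ (i : Fin n) (j : Fin (m (i'.succAbove i))), 2 ≤ v (i'.succAbove i) j)
    (b : BellVec (fun i => m (i'.succAbove i)) (fun i => v (i'.succAbove i)))
    (hb : IsValidIneq (bellPolytope (fun i => m (i'.succAbove i)) (fun i => v (i'.succAbove i)))
      (dotForm b) 0) :
    SupportsFacet (bellPolytope (fun i => m (i'.succAbove i)) (fun i => v (i'.succAbove i)))
        (dotForm b) 0 ↔
      SupportsFacet (bellPolytope m v) (dotForm b ∘ₗ restrictParty i' j' k') 0 := by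
  classical
  have hX := range_detVec_eq (m := m) (v := v) i'
  set R := restrictParty (m := m) (v := v) i' j' k' with hR
  have hdet : ∀ lam, 0 ≤ dotForm b (detVec lam) := fun lam => hb _ (detVec_mem_bellPolytope lam)
  have hgen : ∀ x ∈ Set.range (detVec (m := m) (v := v)), 0 ≤ (dotForm b ∘ₗ R) x := by
    rw [hX]
    rintro _ ⟨mu, lam, rfl⟩
    by_cases h : mu j' = k'
    · simpa [hR, restrictParty_extendParty_of_eq j' k' h] using hdet lam
    · simp [hR, restrictParty_extendParty_of_ne j' k' h]
  have hvalid : IsValidIneq (bellPolytope m v) (dotForm b ∘ₗ R) 0 :=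
    convexHull_min hgen (convex_halfSpace_ge (dotForm b ∘ₗ R).isLinear 0)
  obtain ⟨k, hk⟩ : ∃ k : Fin (v i' j'), k ≠ k' := by
    have : Nontrivial (Fin (v i' j')) := Fin.nontrivial_iff_two_le.2 hv'
    exact exists_ne k'
  -- Only the value at `j'` matters: it makes `extendParty i' mu₀` a right inverse of `R`.
  let mu₀ : (j : Fin (m i')) → Fin (v i' j) := Function.update (fun j => ⟨0, hv i' j⟩) j' k'
  have hmu₀ : mu₀ j' = k' := by simp [mu₀]
  rw [supportsFacet_iff_finrank _ _ hb (totalProb_eq_one_of_mem fun i => ⟨0, hm _⟩)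
      (bellPolytope_nontrivial (fun _ => hm _) (fun _ _ => hv _ _) hB),
    supportsFacet_iff_finrank _ _ hvalid (totalProb_eq_one_of_mem fun i => ⟨0, hm _⟩)
      (bellPolytope_nontrivial hm hv ⟨i', j', hv'⟩)]
  unfold bellPolytope
  rw [span_supportedFace_convexHull _ _ hgen,
    span_supportedFace_convexHull _ _ (by rintro _ ⟨lam, rfl⟩; exact hdet lam),
    span_convexHull, span_convexHull]
  set G := Submodule.span ℝ {x ∈ Set.range (detVec (m := m) (v := v)) | (dotForm b ∘ₗ R) x = 0}
    with hG
  have memG : ∀ mu lam, mu j' ≠ k' → extendParty i' mu (detVec lam) ∈ G := by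
    intro mu lam h
    refine Submodule.subset_span ⟨hX ▸ ⟨mu, lam, rfl⟩, ?_⟩
    simp [hR, restrictParty_extendParty_of_ne j' k' h]
  have hsub : ∀ x ∈ Submodule.span ℝ (Set.range (detVec (m := m) (v := v))),
      x - extendParty i' mu₀ (R x) ∈ G := by
    have hle : Submodule.span ℝ (Set.range (detVec (m := m) (v := v))) ≤
        G.comap (LinearMap.id - extendParty i' mu₀ ∘ₗ R) := by
      rw [Submodule.span_le, hX]
      rintro _ ⟨mu, lam, rfl⟩
      by_cases h : mu j' = k'
      -- Switching the outcome at `j'` to `k ≠ k'` in both strategies keeps the difference and puts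
      -- each term in `G`.
      · have e := extendParty_sub_extendParty_update j' mu mu₀ (h.trans hmu₀.symm) k (detVec lam)
        simp only [SetLike.mem_coe, Submodule.mem_comap, LinearMap.sub_apply, LinearMap.id_apply,
          LinearMap.comp_apply, hR, restrictParty_extendParty_of_eq j' k' h, e]
        exact sub_mem (memG _ _ (by simpa using hk)) (memG _ _ (by simpa using hk))
      · simpa [hR, restrictParty_extendParty_of_ne j' k' h] using memG mu lam h
    exact hle
  have hker : Submodule.span ℝ (Set.range (detVec (m := m) (v := v))) ⊓ LinearMap.ker R ≤ G := by
    rintro x ⟨hx, hx'⟩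
    simpa [LinearMap.mem_ker.1 hx'] using hsub x hx
  rw [finrank_add_one_eq_iff_map R (Submodule.span_mono (Set.sep_subset _ _)) hker]
  have hmapG : G.map R = Submodule.span ℝ {x ∈ Set.range detVec | dotForm b x = 0} := by
    apply le_antisymm
    · rw [hG, Submodule.map_span_le]
      rintro x ⟨hx, hx'⟩
      rw [hX] at hx
      obtain ⟨mu, lam, rfl⟩ := hx
      by_cases h : mu j' = k'
      · rw [LinearMap.comp_apply, hR, restrictParty_extendParty_of_eq j' k' h] at hx'
        rw [hR, restrictParty_extendParty_of_eq j' k' h]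
        exact Submodule.subset_span ⟨⟨lam, rfl⟩, hx'⟩
      · rw [hR, restrictParty_extendParty_of_ne j' k' h]
        exact zero_mem _
    · rw [Submodule.span_le]
      rintro _ ⟨⟨lam, rfl⟩, h⟩
      have e : R (extendParty i' mu₀ (detVec lam)) = detVec lam :=
        restrictParty_extendParty_of_eq j' k' hmu₀ _
      refine ⟨extendParty i' mu₀ (detVec lam), Submodule.subset_span ⟨hX ▸ ⟨mu₀, lam, rfl⟩, ?_⟩, e⟩
      rw [LinearMap.comp_apply, e, h]
  have hmap : (Submodule.span ℝ (Set.range (detVec (m := m) (v := v)))).map R =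
      Submodule.span ℝ (Set.range detVec) := by
    apply le_antisymm
    · rw [Submodule.map_span_le, hX]
      rintro _ ⟨mu, lam, rfl⟩
      by_cases h : mu j' = k'
      · rw [hR, restrictParty_extendParty_of_eq j' k' h]
        exact Submodule.subset_span ⟨lam, rfl⟩
      · rw [hR, restrictParty_extendParty_of_ne j' k' h]
        exact zero_mem _
    · rw [Submodule.span_le]
      rintro _ ⟨lam, rfl⟩
      exact ⟨extendParty i' mu₀ (detVec lam), Submodule.subset_span (hX ▸ ⟨mu₀, lam, rfl⟩),
        restrictParty_extendParty_of_eq j' k' hmu₀ _⟩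
  rw [hmapG, hmap]
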